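/- **Remote $n$-Gability, Condition I.** Let $G=(P_1,P_2,E)$ be a finite two-colorable simple graph: $V=P_1\sqcup P_2$ and every edge joins $P_1$ to $P_2$. Let $|G\rangle=\prod_{\{u,v\}\in E}CZ_{uv}\,|+\rangle^{\otimes V}$ be its graph state, one qubit per node. A *star vertex* is a vertex $v\in P_j$ whose neighborhood is the whole opposite partition $V\setminus P_j$; write $S_j\subseteq P_j$ for the set of star vertices of $P_j$ and $V_j=P_j\setminus S_j$. The *opposite remote set* $\overline N(v)$ of $v\in P_j$ is the set of vertices of $V\setminus P_j$ not adjacent to $v$. An *LC+LPM+CC protocol* is a finite sequence of single-qubit Clifford operations and single-qubit Pauli measurements, in which each step may depend on all earlier measurement outcomes. Suppose that $S_1\neq\emptyset$ and $S_2\neq\emptyset$. Let $n\ge 1$, let $i\in\{1,2\}$, and let $A_g\subseteq V_i$ satisfy $|\overline N(v)|\ge n-1$ for all $v\in A_g$ and $\overline N(v)\cap\overline N(w)=\emptyset$ for all distinct $v,w\in A_g$. (For $n\ge2$, $A_g\subseteq V_i$ is the same as $A_g\subseteq P_i$, given these inequalities.) Then: 1. There are $|A_g|$ pairwise disjoint sets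 of $n$ vertices each, every one of them consisting of pairwise non-adjacent (mutually remote) vertices of $G$, and an LC+LPM+CC protocol that, whatever the measurement outcomes, transforms $|G\rangle$ into a product of $n$-qubit GHZ states $(|0\cdots0\rangle+|1\cdots1\rangle)/\sqrt2$, one on each of these sets, and a state of the remaining qubits. 2. Such a protocol is explicit. Choose any $s\in S_i$, any $t\in S_j$ with $j\neq i$, and any sets $R(v)\subseteq\overline N(v)$ for $v\in A_g$. Measure in the Pauli-$Z$ basis all the qubits outside $A_g\cup\bigcup_{v\in A_g}R(v)\cup\{s,t\}$, in any order, then measure qubit $t$ and then qubit $s$ in the Pauli-$X$ basis. For every sequence of outcomes, single-qubit Clifford operations depending only on the outcomes turn the resulting state into a product of GHZ states, one on each of the pairwise disjoint sets $\{v\}\cup R(v)$, $v\in A_g$, and a state of the remaining qubits; each set $\{v\}\cup R(v)$ consists of mutually remote vertices. (With $|R(v)|=n-1$ these are $n$-qubit GHZ states.) -/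

import Mathlib

open scoped Matrix

namespace RemoteGHZ

/-! ### Qubits, graph states, GHZ states -/

/-- A (not necessarily normalised) pure state of qubits labelled by `V`, given by its amplitudes
in the computational basis.  Nonzero vectors that differ by a scalar describe the same state. -/
abbrev QState (V : Type*) := (V → Fin 2) → ℂ

/-- The graph state `|G⟩`: the state `|+⟩` on every vertex followed by a controlled-`Z` on every
edge.  The amplitude of `|x⟩` is `2^(-|V|/2)` times one factor `-1` for each edge
both of whose endpoints carry the value `1`. -/
noncomputable def graphState {V : Type*} [Fintype V] [DecidableEq V]
    (G : SimpleGraph V) [DecidableRel G.Adj] : QState V :=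
  fun x => ((Real.sqrt 2 : ℂ)⁻¹) ^ Fintype.card V *
    ∏ e ∈ G.edgeFinset, (if ∀ v, v ∈ e → x v = 1 then (-1 : ℂ) else 1)

/-- The GHZ state `(|0…0⟩ + |1…1⟩)/√2` on the qubits `ι`. -/
noncomputable def ghz (ι : Type*) [Fintype ι] : QState ι :=
  fun x => (Real.sqrt 2 : ℂ)⁻¹ *
    ((if ∀ i, x i = 0 then 1 else 0) + (if ∀ i, x i = 1 then 1 else 0))

/-- `ψ` is the product of a GHZ state on each of the sets of qubits `U k` and
of some state of the other qubits. -/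
def CarriesGHZ {V κ : Type*} [Fintype κ] (U : κ → Finset V) (ψ : QState V) : Prop :=
  ∃ φ : QState {v : V // ∀ k, v ∉ U k}, ∀ x : V → Fin 2,
    ψ x = (∏ k, ghz (U k) (fun u => x u)) * φ (fun v => x v)

/-! ### Local Clifford operations, local Pauli measurements, classical communication -/

/-- The three Pauli observables. -/
inductive Pauli
  | X
  | Y
  | Z

/-- The matrix of a Pauli observable. -/
def Pauli.mat : Pauli → Matrix (Fin 2) (Fin 2) ℂ
  | .X => !![0, 1; 1, 0]
  | .Y => !![0, -Complex.I; Complex.I, 0]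
  | .Z => !![1, 0; 0, -1]

/-- The projector onto the eigenspace of a Pauli observable for the outcome `(-1)^b`. -/
noncomputable def Pauli.proj (P : Pauli) (b : Fin 2) : Matrix (Fin 2) (Fin 2) ℂ :=
  (2 : ℂ)⁻¹ • (1 + ((-1 : ℂ) ^ (b : ℕ)) • P.mat)

/-- Single-qubit Clifford operations: unitaries that map every Pauli matrix to plus or minus a
Pauli matrix under conjugation. -/
def IsClifford (C : Matrix (Fin 2) (Fin 2) ℂ) : Prop :=
  C ∈ Matrix.unitaryGroup (Fin 2) ℂ ∧
    ∀ P : Pauli, ∃ Q : Pauli, C * P.mat * Cᴴ = Q.mat ∨ C * P.mat * Cᴴ = -Q.mat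

/-- The single-qubit operator `M` acting on the qubit `v` (and the identity on all others). -/
def applyAt {V : Type*} [DecidableEq V] (v : V) (M : Matrix (Fin 2) (Fin 2) ℂ)
    (ψ : QState V) : QState V :=
  fun x => ∑ b, M (x v) b * ψ (Function.update x v b)

/-- LC + LPM + CC protocols on the qubits `V`, one qubit per node: finite adaptive sequences of
single-qubit Clifford operations and single-qubit Pauli measurements.  Measurement outcomes are
broadcast, so everything that comes after a measurement may depend on its outcome. -/
inductive Protocol (V : Type*)
  | done : Protocol V
  | clifford (v : V) (C : Matrix (Fin 2) (Fin 2) ℂ) (hC : IsClifford C)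
      (next : Protocol V) : Protocol V
  | measure (v : V) (P : Pauli) (next : Fin 2 → Protocol V) : Protocol V

/-- Running the protocol on the state `ψ` ends in a state with the property `Q`, whatever the
outcomes of the measurements.  Only outcomes of nonzero probability, that is with a nonzero
projected state, count; projected states are not renormalised. -/
def Protocol.Guarantees {V : Type*} [DecidableEq V] :
    Protocol V → QState V → (QState V → Prop) → Prop
  | .done, ψ, Q => Q ψ
  | .clifford v C _ next, ψ, Q => next.Guarantees (applyAt v C ψ) Q
  | .measure v P next, ψ, Q =>
      ∀ b : Fin 2, applyAt v (P.proj b) ψ ≠ 0 → (next b).Guarantees (applyAt v (P.proj b) ψ) Q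

/-- The protocol consists of local Clifford operations only. -/
def Protocol.NoMeasurement {V : Type*} : Protocol V → Prop
  | .done => True
  | .clifford _ _ _ next => next.NoMeasurement
  | .measure _ _ _ => False

/-- Perform the listed Pauli measurements one after the other, then continue with the
protocol that `next` assigns to the list of outcomes. -/
def Protocol.measureList {V : Type*} : List (V × Pauli) → (List (Fin 2) → Protocol V) → Protocol V
  | [], next => next []
  | m :: l, next =>
      .measure m.1 m.2 fun b => Protocol.measureList l fun bs => next (b :: bs)

/-! ### Extraction of GHZ states among remote nodes -/

/-- The protocol `p` turns the graph state `|G⟩` with certainty into simultaneous GHZ states on the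
pairwise disjoint sets `U k`, each of which consists of pairwise non-adjacent vertices of `G`. -/
def ExtractsRemoteGHZ {V κ : Type*} [Fintype V] [DecidableEq V] [Fintype κ]
    (G : SimpleGraph V) [DecidableRel G.Adj] (U : κ → Finset V) (p : Protocol V) : Prop :=
  (∀ k l, k ≠ l → Disjoint (U k) (U l)) ∧
  (∀ k, G.IsIndepSet (U k : Set V)) ∧
  p.Guarantees (graphState G) (CarriesGHZ U)

/-- `r` GHZ states, each on `n` pairwise remote nodes, can be extracted concurrently from `|G⟩`
by LC + LPM + CC. -/
def CanExtractRemoteGHZ {V : Type*} [Fintype V] [DecidableEq V]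
    (G : SimpleGraph V) [DecidableRel G.Adj] (r n : ℕ) : Prop :=
  ∃ U : Fin r → Finset V, (∀ k, (U k).card = n) ∧ ∃ p : Protocol V, ExtractsRemoteGHZ G U p

/-! ### Two-colorable graphs: the partition `P_i` is the set of vertices of colour `i : Bool` -/

/-- The star vertices in the partition `i`: their neighbourhood is the whole opposite partition. -/
def starVertices {V : Type*} {G : SimpleGraph V} (c : G.Coloring Bool) (i : Bool) : Set V :=
  {v | c v = i ∧ G.neighborSet v = c.colorClass (!i)}

/-- The opposite remote set of `v`: the vertices of the other partition not adjacent to `v`. -/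
def oppositeRemoteSet {V : Type*} [Fintype V] {G : SimpleGraph V}
    [DecidableRel G.Adj] (c : G.Coloring Bool) (v : V) : Finset V :=
  {w | c w ≠ c v ∧ ¬ G.Adj v w}

end RemoteGHZ

open RemoteGHZ

/-!
The amplitude of a graph state is a product of signs `(-1)^(x u * x w)` over the edges. For a
two-colorable graph, multiply and divide by the signs of the pairs of opposite colour that are not
adjacent: what results is the sign `(-1)^(σ₁ σ₂)` of the complete bipartite graph, which only
involves the parities `σ₁`, `σ₂` of the two parts, times one sign for each non-adjacent opposite
pair (`graphState_eq_remote`). Star vertices belong to no such pair, so they enter only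
through `σ₁` and `σ₂`. Measuring one star vertex of each part in the Pauli-`X` basis therefore
removes the factor `(-1)^(σ₁ σ₂)` and leaves single-qubit signs in its place
(`applyAt_proj_X_proj_X`, `project_graphState`). What is left is, up to single-qubit signs, the graph
state of the bipartite complement.

The Pauli-`Z` measurements give definite values to all other qubits outside
`T = A ∪ ⋃ v ∈ A, R v`, so that a non-adjacent pair with at most one vertex in `T` also contributes
only a single-qubit sign or a constant (`exists_local_signs`). The pairs inside `T` are exactly
the pairs `{v, r}` with `v ∈ A` and `r ∈ R v`, because the opposite remote sets of the vertices of
`A` are disjoint: they form a disjoint union of stars. Powers of Pauli-`Z` on `T` cancel the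
single-qubit signs, and Hadamard gates on the leaves turn each star into a GHZ state
(`applyEach_hadamard`, `ghz_insert`).
-/

namespace RemoteGHZ

/-! ### Signs of controlled-`Z` gates -/

/-- The sign `(-1)^(ab)` that a controlled-`Z` gate attaches to the basis state `|a, b⟩`. -/
noncomputable def czSign (a b : Fin 2) : ℂ := if a = 1 ∧ b = 1 then -1 else 1

lemma czSign_comm (a b : Fin 2) : czSign a b = czSign b a := by
  simp only [czSign, and_comm]

@[simp] lemma czSign_zero_left (b : Fin 2) : czSign 0 b = 1 := by simp [czSign]

lemma czSign_add_left (a b d : Fin 2) : czSign (a + b) d = czSign a d * czSign b d := by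
  fin_cases a <;> fin_cases b <;> fin_cases d <;> simp [czSign]

lemma czSign_mul_self (a b : Fin 2) : czSign a b * czSign a b = 1 := by
  fin_cases a <;> fin_cases b <;> simp [czSign]

lemma czSign_sum_left {ι : Type*} (S : Finset ι) (f : ι → Fin 2) (b : Fin 2) :
    czSign (∑ k ∈ S, f k) b = ∏ k ∈ S, czSign (f k) b := by
  classical
  induction S using Finset.induction_on with
  | empty => simp
  | insert a S ha ih => rw [Finset.sum_insert ha, Finset.prod_insert ha, czSign_add_left, ih]

lemma czSign_sum_right {ι : Type*} (S : Finset ι) (f : ι → Fin 2) (a : Fin 2) :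
    czSign a (∑ k ∈ S, f k) = ∏ k ∈ S, czSign a (f k) := by
  simp only [czSign_comm a, czSign_sum_left]

/-! ### Single-qubit operators applied to several qubits -/

section Operators

variable {V : Type*} [DecidableEq V]

lemma applyAt_diagonal (v : V) (d : Fin 2 → ℂ) (ψ : QState V) (x : V → Fin 2) :
    applyAt v (Matrix.diagonal d) ψ x = d (x v) * ψ x := by
  unfold applyAt
  rw [Finset.sum_eq_single (x v)]
  · simp
  · intro b _ hb
    simp [Matrix.diagonal_apply_ne _ hb.symm]
  · simp

lemma proj_Z (b : Fin 2) :
    Pauli.Z.proj b = Matrix.diagonal fun y => if y = b then 1 else 0 := by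
  ext y z
  fin_cases b <;> fin_cases y <;> fin_cases z <;> simp [Pauli.proj, Pauli.mat] <;> norm_num

lemma proj_X_apply (b y z : Fin 2) :
    Pauli.X.proj b y z = 2⁻¹ * (czSign b y * czSign b z) := by
  fin_cases b <;> fin_cases y <;> fin_cases z <;> simp [Pauli.proj, Pauli.mat, czSign]

/-- The Pauli-`Z` correction `Z ^ f`. -/
noncomputable def phaseFlip (f : Fin 2) : Matrix (Fin 2) (Fin 2) ℂ :=
  Matrix.diagonal (czSign f)

/-- The Hadamard gate. -/
noncomputable def hadamard : Matrix (Fin 2) (Fin 2) ℂ :=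
  Matrix.of fun y z => (Real.sqrt 2 : ℂ)⁻¹ * czSign y z

lemma isClifford_phaseFlip (f : Fin 2) : IsClifford (phaseFlip f) := by
  refine ⟨?_, fun P => ⟨P, ?_⟩⟩
  · rw [Matrix.mem_unitaryGroup_iff]
    ext y z
    fin_cases f <;> fin_cases y <;> fin_cases z <;>
      simp [phaseFlip, czSign, Matrix.mul_apply, Matrix.star_eq_conjTranspose]
  · have key : ∀ y z, (phaseFlip f * P.mat * (phaseFlip f)ᴴ) y z =
        czSign f y * P.mat y z * czSign f z := by
      intro y z
      have hc : star (czSign f z) = czSign f z := by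
        fin_cases f <;> fin_cases z <;> simp [czSign]
      rw [phaseFlip, Matrix.diagonal_conjTranspose, Matrix.mul_diagonal, Matrix.diagonal_mul,
        Pi.star_apply, hc]
    cases P
    case Z =>
      left; ext y z; rw [key]
      fin_cases f <;> fin_cases y <;> fin_cases z <;> simp [Pauli.mat, czSign]
    all_goals
      rcases (by decide : ∀ a : Fin 2, a = 0 ∨ a = 1) f with rfl | rfl
      · left; ext y z; rw [key]; simp
      · right; ext y z; rw [key]
        fin_cases y <;> fin_cases z <;> simp [Pauli.mat, czSign]

lemma sqrt_two_inv_mul_self : (Real.sqrt 2 : ℂ)⁻¹ * (Real.sqrt 2 : ℂ)⁻¹ = 2⁻¹ := by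
  rw [← mul_inv, ← Complex.ofReal_mul, Real.mul_self_sqrt (by norm_num)]
  norm_num

lemma hadamard_conjTranspose : hadamardᴴ = hadamard := by
  ext y z
  fin_cases y <;> fin_cases z <;> simp [hadamard, czSign]

lemma isClifford_hadamard : IsClifford hadamard := by
  have hs := sqrt_two_inv_mul_self
  refine ⟨?_, fun P => ?_⟩
  · rw [Matrix.mem_unitaryGroup_iff, Matrix.star_eq_conjTranspose, hadamard_conjTranspose]
    ext y z
    fin_cases y <;> fin_cases z <;>
      simp [hadamard, czSign, Matrix.mul_apply, Fin.sum_univ_two, hs]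
    all_goals norm_num
  · rw [hadamard_conjTranspose]
    cases P
    · refine ⟨.Z, Or.inl ?_⟩
      ext y z
      fin_cases y <;> fin_cases z <;>
        simp [hadamard, czSign, Pauli.mat, Matrix.mul_apply, Fin.sum_univ_two, hs] <;> norm_num
    · refine ⟨.Y, Or.inr ?_⟩
      ext y z
      fin_cases y <;> fin_cases z <;>
        simp [hadamard, czSign, Pauli.mat, Matrix.mul_apply, Fin.sum_univ_two] <;>
        first
          | linear_combination (2 * Complex.I) * hs
          | linear_combination (-2 * Complex.I) * hs
    · refine ⟨.X, Or.inl ?_⟩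
      ext y z
      fin_cases y <;> fin_cases z <;>
        simp [hadamard, czSign, Pauli.mat, Matrix.mul_apply, Fin.sum_univ_two, hs] <;> norm_num

/-- Apply the operator `C v` to the qubit `v`, for the entries `v` of a list one after the other. -/
def applyEach (C : V → Matrix (Fin 2) (Fin 2) ℂ) : List V → QState V → QState V
  | [], ψ => ψ
  | v :: l, ψ => applyEach C l (applyAt v (C v) ψ)

lemma applyEach_diagonal (d : V → Fin 2 → ℂ) (l : List V) (ψ : QState V) (x : V → Fin 2) :
    applyEach (fun v => Matrix.diagonal (d v)) l ψ x = (l.map fun v => d v (x v)).prod * ψ x := by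
  induction l generalizing ψ with
  | nil => simp [applyEach]
  | cons v l ih =>
    rw [applyEach, ih, applyAt_diagonal, List.map_cons, List.prod_cons]
    ring

lemma sum_hadamard_czSign (y a : Fin 2) :
    ∑ b, hadamard y b * czSign a b = Real.sqrt 2 * if y = a then 1 else 0 := by
  have hs : (Real.sqrt 2 : ℂ) = 2 * (Real.sqrt 2 : ℂ)⁻¹ := by
    have h0 : (Real.sqrt 2 : ℂ) ≠ 0 := by simp
    linear_combination (-2 * (Real.sqrt 2 : ℂ)) * sqrt_two_inv_mul_self +
      2 * (Real.sqrt 2 : ℂ)⁻¹ * mul_inv_cancel₀ h0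
  fin_cases y <;> fin_cases a <;>
    simp [hadamard, czSign, Fin.sum_univ_two] <;> linear_combination -hs

/-- Hadamard gates on the leaves of a star forest: they turn the controlled-`Z` sign of a leaf
and its centre into the condition that leaf and centre carry the same value. -/
lemma applyEach_hadamard (ctr : V → V) (l : List V) (hl : l.Nodup)
    (hctr : ∀ r ∈ l, ctr r ∉ l) (h ψ : QState V)
    (hh : ∀ x, ∀ r ∈ l, ∀ b, h (Function.update x r b) = h x)
    (hψ : ∀ x, ψ x = (l.map fun r => czSign (x (ctr r)) (x r)).prod * h x) (x : V → Fin 2) :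
    applyEach (fun _ => hadamard) l ψ x =
      (l.map fun r => (Real.sqrt 2 : ℂ) * if x r = x (ctr r) then 1 else 0).prod * h x := by
  induction l generalizing ψ h with
  | nil => simp [applyEach, hψ]
  | cons r l ih =>
    rw [List.nodup_cons] at hl
    rw [applyEach, ih hl.2 (fun u hu => fun h' => hctr u (by simp [hu]) (by simp [h']))
      (fun x => ((Real.sqrt 2 : ℂ) * if x r = x (ctr r) then 1 else 0) * h x)]
    · simp only [List.map_cons, List.prod_cons]; ring
    · intro x u hu b
      have h1 : u ≠ r := fun e => hl.1 (e ▸ hu)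
      have h2 : u ≠ ctr r := fun e => hctr r (by simp) (by simp [← e, hu])
      simp only [Function.update_of_ne h1.symm, Function.update_of_ne h2.symm]
      rw [hh x u (by simp [hu])]
    · intro x
      have hrr : ctr r ≠ r := fun e => hctr r (by simp) (by simp [e])
      rw [← sum_hadamard_czSign, Finset.sum_mul, Finset.mul_sum]
      refine Finset.sum_congr rfl fun b _ => ?_
      have hl' : (l.map fun u => czSign (Function.update x r b (ctr u))
          (Function.update x r b u)) = l.map fun u => czSign (x (ctr u)) (x u) := by
        refine List.map_congr_left fun u hu => ?_
        have h1 : u ≠ r := fun e => hl.1 (e ▸ hu)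
        have h2 : ctr u ≠ r := fun e => hctr u (by simp [hu]) (by simp [e])
        rw [Function.update_of_ne h1, Function.update_of_ne h2]
      rw [hψ, hh x r (by simp), List.map_cons, List.prod_cons, hl', Function.update_self,
        Function.update_of_ne hrr]
      ring

/-- Sum over the two qubits of a Pauli-`X` measurement of `t` and then of `s`, in the case that the
state depends on them only through the single sign `(-1)^((x s + p)(x t + q))`. -/
lemma sum_sum_czSign (bs bt p q : Fin 2) :
    ∑ y, czSign bs y * ∑ z, czSign bt z * czSign (y + p) (z + q) =
      2 * (czSign bs bt * czSign bs p * czSign bt q) := by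
  fin_cases bs <;> fin_cases bt <;> fin_cases p <;> fin_cases q <;>
    simp [czSign, Fin.sum_univ_two] <;> norm_num

/-- Measuring `t` and then `s` in the Pauli-`X` basis replaces the sign `(-1)^((x s + p)(x t + q))`
by signs that involve `p` and `q` separately. -/
lemma applyAt_proj_X_proj_X {s t : V} (hst : s ≠ t) (bs bt : Fin 2) (p q : (V → Fin 2) → Fin 2)
    (E ψ : QState V)
    (hp : ∀ x y z, p (Function.update (Function.update x s y) t z) = p x)
    (hq : ∀ x y z, q (Function.update (Function.update x s y) t z) = q x)
    (hE : ∀ x y z, E (Function.update (Function.update x s y) t z) = E x)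
    (hψ : ∀ x, ψ x = czSign (x s + p x) (x t + q x) * E x) (x : V → Fin 2) :
    applyAt s (Pauli.X.proj bs) (applyAt t (Pauli.X.proj bt) ψ) x =
      2⁻¹ * (czSign bs bt * czSign bs (x s) * czSign bt (x t)) *
        (czSign bs (p x) * czSign bt (q x) * E x) := by
  simp only [applyAt, hψ, proj_X_apply, hp, hq, hE, Function.update_self,
    Function.update_of_ne hst, Function.update_of_ne hst.symm]
  have := sum_sum_czSign bs bt (p x) (q x)
  simp only [Fin.sum_univ_two] at this ⊢
  linear_combination 4⁻¹ * czSign bs (x s) * czSign bt (x t) * E x * this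

end Operators

/-! ### Protocols -/

section Protocols

variable {V : Type*}

/-- Apply the Clifford operation `C v` to the qubit `v`, for the entries `v` of a list one after
the other, and continue with `next`. -/
def Protocol.cliffordEach (C : V → Matrix (Fin 2) (Fin 2) ℂ) (hC : ∀ v, IsClifford (C v)) :
    List V → Protocol V → Protocol V
  | [], next => next
  | v :: l, next => .clifford v (C v) (hC v) (Protocol.cliffordEach C hC l next)

lemma noMeasurement_cliffordEach {C : V → Matrix (Fin 2) (Fin 2) ℂ}
    {hC : ∀ v, IsClifford (C v)} {l : List V} {next : Protocol V} (h : next.NoMeasurement) :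
    (Protocol.cliffordEach C hC l next).NoMeasurement := by
  induction l with
  | nil => exact h
  | cons v l ih => exact ih

variable [DecidableEq V]

lemma Protocol.Guarantees.mono {p : Protocol V} {ψ : QState V} {Q Q' : QState V → Prop}
    (h : p.Guarantees ψ Q) (hQ : ∀ φ, Q φ → Q' φ) : p.Guarantees ψ Q' := by
  induction p generalizing ψ with
  | done => exact hQ _ h
  | clifford v C hC next ih => exact ih h
  | measure v P next ih => exact fun b hb => ih b (h b hb)

/-- The unnormalised state after the listed Pauli measurements with the given outcomes.  If the two
lists differ in length, the surplus entries of the longer one are ignored. -/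
noncomputable def project : List (V × Pauli) → List (Fin 2) → QState V → QState V
  | m :: l, b :: bs, ψ => project l bs (applyAt m.1 (m.2.proj b) ψ)
  | _, _, ψ => ψ

lemma guarantees_measureList {l : List (V × Pauli)} {next : List (Fin 2) → Protocol V}
    {ψ : QState V} {Q : QState V → Prop}
    (h : ∀ bs : List (Fin 2), bs.length = l.length → (next bs).Guarantees (project l bs ψ) Q) :
    (Protocol.measureList l next).Guarantees ψ Q := by
  induction l generalizing next ψ with
  | nil => exact h [] rfl
  | cons m l ih =>
    intro b _
    exact ih fun bs hbs => h (b :: bs) (by simp [hbs])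

lemma project_append (l l' : List (V × Pauli)) (bs bs' : List (Fin 2)) (ψ : QState V)
    (h : bs.length = l.length) :
    project (l ++ l') (bs ++ bs') ψ = project l' bs' (project l bs ψ) := by
  induction l generalizing bs ψ with
  | nil =>
    obtain rfl : bs = [] := List.length_eq_zero_iff.1 h
    simp [project]
  | cons m l ih =>
    cases bs with
    | nil => simp at h
    | cons b bs => simpa [project] using ih bs _ (by simpa using h)

lemma project_Z (zs : List V) (β : V → Fin 2) (ψ : QState V) (x : V → Fin 2) :
    project (zs.map fun w => (w, Pauli.Z)) (zs.map β) ψ x =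
      if ∀ w ∈ zs, x w = β w then ψ x else 0 := by
  induction zs generalizing ψ with
  | nil => simp [project]
  | cons z zs ih =>
    simp only [List.map_cons, project, ih, proj_Z, applyAt_diagonal, List.forall_mem_cons]
    by_cases h1 : x z = β z <;> simp [h1]

lemma guarantees_cliffordEach {C : V → Matrix (Fin 2) (Fin 2) ℂ} {hC : ∀ v, IsClifford (C v)}
    {l : List V} {next : Protocol V} {ψ : QState V} {Q : QState V → Prop} :
    (Protocol.cliffordEach C hC l next).Guarantees ψ Q ↔
      next.Guarantees (applyEach C l ψ) Q := by
  induction l generalizing ψ with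
  | nil => rfl
  | cons v l ih => exact ih

end Protocols

/-! ### GHZ states -/

section GHZ

variable {V : Type*}

lemma CarriesGHZ.reindex {κ κ' : Type*} [Fintype κ] [Fintype κ'] (e : κ' ≃ κ)
    {U : κ → Finset V} {ψ : QState V} (h : CarriesGHZ U ψ) :
    CarriesGHZ (fun k => U (e k)) ψ := by
  obtain ⟨φ, hφ⟩ := h
  refine ⟨fun y => φ fun v => y ⟨v.1, fun k => v.2 (e k)⟩, fun x => ?_⟩
  rw [hφ, ← Equiv.prod_comp e]

variable [DecidableEq V]

lemma ghz_insert (v : V) (S : Finset V) (x : V → Fin 2) :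
    ghz (insert v S : Finset V) (fun u => x u) =
      (Real.sqrt 2 : ℂ)⁻¹ * ∏ r ∈ S, if x r = x v then 1 else 0 := by
  have hx : ∀ a : Fin 2, (∀ u : (insert v S : Finset V), x u = a) ↔
      x v = a ∧ ∀ r ∈ S, x r = x v := by
    intro a
    rw [Subtype.forall]
    constructor
    · intro h
      have hv := h v (by simp)
      exact ⟨hv, fun r hr => (h r (by simp [hr])).trans hv.symm⟩
    · rintro ⟨hv, h⟩ u hu
      rcases Finset.mem_insert.1 hu with rfl | hu
      · exact hv
      · exact (h u hu).trans hv
  rw [ghz, Finset.prod_boole]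
  simp only [hx]
  rcases (by decide : ∀ a : Fin 2, a = 0 ∨ a = 1) (x v) with h | h <;> simp [h]

lemma ExtractsRemoteGHZ.reindex {κ κ' : Type*} [Fintype V] [Fintype κ] [Fintype κ'] (e : κ' ≃ κ)
    {G : SimpleGraph V} [DecidableRel G.Adj] {U : κ → Finset V} {p : Protocol V}
    (h : ExtractsRemoteGHZ G U p) : ExtractsRemoteGHZ G (fun k => U (e k)) p :=
  ⟨fun _ _ hkl => h.1 _ _ (e.injective.ne hkl), fun k => h.2.1 (e k),
    h.2.2.mono fun _ => CarriesGHZ.reindex e⟩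

end GHZ

/-! ### The graph state of a two-colorable graph with star vertices -/

section Graph

variable {V : Type*} [Fintype V] {G : SimpleGraph V} [DecidableRel G.Adj]

lemma mem_oppositeRemoteSet {c : G.Coloring Bool} {v w : V} :
    w ∈ oppositeRemoteSet c v ↔ c w ≠ c v ∧ ¬ G.Adj v w := by
  simp [oppositeRemoteSet]

lemma mem_oppositeRemoteSet_comm {c : G.Coloring Bool} {v w : V} :
    w ∈ oppositeRemoteSet c v ↔ v ∈ oppositeRemoteSet c w := by
  simp only [mem_oppositeRemoteSet, ne_comm, G.adj_comm]

lemma notMem_oppositeRemoteSet_of_mem_starVertices {c : G.Coloring Bool} {j : Bool} {s : V}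
    (hs : s ∈ starVertices c j) (v : V) : s ∉ oppositeRemoteSet c v := by
  rw [mem_oppositeRemoteSet_comm, mem_oppositeRemoteSet]
  rintro ⟨hc, hadj⟩
  have hv : v ∈ c.colorClass (!j) := by
    change c v = !j
    rw [← hs.1]
    exact Bool.eq_not.2 hc
  rw [← hs.2] at hv
  exact hadj hv

variable [DecidableEq V]

lemma graphState_eq_prod (c : G.Coloring Bool) (i : Bool) (x : V → Fin 2) :
    graphState G x = ((Real.sqrt 2 : ℂ)⁻¹) ^ Fintype.card V *
      ∏ u with c u = i, ∏ w with c w = !i, if G.Adj u w then czSign (x u) (x w) else 1 := by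
  rw [graphState]
  congr 1
  simp_rw [← Finset.prod_filter (fun w => G.Adj _ w)]
  rw [Finset.prod_sigma']
  symm
  refine Finset.prod_nbij (fun p => s(p.1, p.2)) ?_ ?_ ?_ ?_
  · rintro ⟨u, w⟩ h
    simp only [Finset.mem_sigma, Finset.mem_filter] at h
    simpa using h.2.2
  · rintro ⟨u, w⟩ h ⟨u', w'⟩ h' he
    simp only [Finset.coe_sigma, Set.mem_sigma_iff, Finset.mem_coe, Finset.mem_filter,
      Finset.mem_univ, true_and] at h h'
    rcases Sym2.eq_iff.1 he with ⟨rfl, rfl⟩ | ⟨rfl, rfl⟩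
    · rfl
    · exfalso
      have h1 := h.1
      have h2 := h'.2.1
      simp only at h1 h2
      rw [h1] at h2
      simp at h2
  · intro e he
    induction e using Sym2.ind with
    | h u w =>
      have hadj : G.Adj u w := by simpa using he
      have hc := c.valid hadj
      rcases Bool.eq_or_eq_not (c u) i with hu | hu
      · refine ⟨⟨u, w⟩, ?_, rfl⟩
        have hw : c w = !i := by rw [← hu]; exact Bool.eq_not.2 hc.symm
        simp [hu, hw, hadj]
      · refine ⟨⟨w, u⟩, ?_, Sym2.eq_swap⟩
        have hw : c w = i := by
          rcases Bool.eq_or_eq_not (c w) i with hw | hw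
          · exact hw
          · exact absurd (hu.trans hw.symm) hc
        simp [hu, hw, hadj.symm]
  · rintro ⟨u, w⟩ _
    simp [czSign, Sym2.mem_iff]

/-- The signs of a bipartite graph state are those of the complete bipartite graph, in which only
the parities of the two parts enter, corrected by one sign for each non-adjacent pair.  Star vertices
occur in no such pair. -/
lemma graphState_eq_remote (c : G.Coloring Bool) (i : Bool) (x : V → Fin 2) :
    graphState G x = ((Real.sqrt 2 : ℂ)⁻¹) ^ Fintype.card V *
      (czSign (∑ u with c u = i, x u) (∑ w with c w = !i, x w) *
        ∏ u with c u = i, ∏ w ∈ oppositeRemoteSet c u, czSign (x u) (x w)) := by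
  rw [graphState_eq_prod c i, czSign_sum_left, ← Finset.prod_mul_distrib]
  congr 1
  refine Finset.prod_congr rfl fun u hu => ?_
  have hR : oppositeRemoteSet c u = Finset.filter (fun w => ¬ G.Adj u w) {w | c w = !i} := by
    ext w
    have hu' : c u = i := by simpa using hu
    simp [mem_oppositeRemoteSet, hu', Bool.eq_not]
  rw [czSign_sum_right, hR, Finset.prod_filter (fun w => ¬ G.Adj u w),
    ← Finset.prod_mul_distrib]
  refine Finset.prod_congr rfl fun w _ => ?_
  by_cases h : G.Adj u w <;> simp [h, czSign_mul_self]

/-- The signs of the non-adjacent pairs, sorted by how many of the two vertices lie in `T`. -/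
lemma prod_remote_split (c : G.Coloring Bool) (i : Bool) (T : Finset V) (x : V → Fin 2) :
    ∏ u with c u = i, ∏ w ∈ oppositeRemoteSet c u, czSign (x u) (x w) =
      (∏ u ∈ T with c u = i, ∏ w ∈ oppositeRemoteSet c u ∩ T, czSign (x u) (x w)) *
      (∏ u ∈ T, ∏ w ∈ oppositeRemoteSet c u \ T, czSign (x w) (x u)) *
      ∏ u ∈ Finset.univ \ T with c u = i, ∏ w ∈ oppositeRemoteSet c u \ T,
        czSign (x u) (x w) := by
  have hin : ∀ u, ∏ w ∈ oppositeRemoteSet c u, czSign (x u) (x w) =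
      (∏ w ∈ oppositeRemoteSet c u ∩ T, czSign (x u) (x w)) *
        ∏ w ∈ oppositeRemoteSet c u \ T, czSign (x u) (x w) := fun u =>
    (Finset.prod_inter_mul_prod_sdiff _ _ _).symm
  have hout : ∀ f : V → ℂ, ∏ u with c u = i, f u =
      (∏ u ∈ T with c u = i, f u) * ∏ u ∈ Finset.univ \ T with c u = i, f u := by
    intro f
    rw [← Finset.prod_union]
    · refine Finset.prod_congr ?_ fun _ _ => rfl
      ext u; simp only [Finset.mem_union, Finset.mem_filter, Finset.mem_sdiff, Finset.mem_univ]
      tauto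
    · rw [Finset.disjoint_left]
      simp +contextual
  have hswap : ∏ u ∈ Finset.univ \ T with c u = i, ∏ w ∈ oppositeRemoteSet c u ∩ T,
      czSign (x u) (x w) =
      ∏ w ∈ T with ¬ c w = i, ∏ u ∈ oppositeRemoteSet c w \ T, czSign (x u) (x w) := by
    refine Finset.prod_comm' fun u w => ?_
    simp only [Finset.mem_filter, Finset.mem_sdiff, Finset.mem_univ, true_and, Finset.mem_inter,
      mem_oppositeRemoteSet, G.adj_comm u w]
    constructor
    · rintro ⟨⟨hu, rfl⟩, ⟨hc, ha⟩, hw⟩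
      exact ⟨⟨⟨hc.symm, ha⟩, hu⟩, hw, hc⟩
    · rintro ⟨⟨⟨hc, ha⟩, hu⟩, hw, hi⟩
      refine ⟨⟨hu, ?_⟩, ⟨hc.symm, ha⟩, hw⟩
      rw [Bool.eq_not.2 hc, Bool.eq_not.2 hi, Bool.not_not]
  rw [hout]
  simp only [hin, Finset.prod_mul_distrib]
  have hcomm : ∏ u ∈ T with c u = i, ∏ w ∈ oppositeRemoteSet c u \ T, czSign (x u) (x w) =
      ∏ u ∈ T with c u = i, ∏ w ∈ oppositeRemoteSet c u \ T, czSign (x w) (x u) :=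
    Finset.prod_congr rfl fun u _ => Finset.prod_congr rfl fun w _ => czSign_comm _ _
  rw [hswap, hcomm, ← Finset.prod_filter_mul_prod_filter_not T (fun u => c u = i)
    (fun u => ∏ w ∈ oppositeRemoteSet c u \ T, czSign (x w) (x u))]
  ring

/-- The power of Pauli-`Z` by which the qubit `u` has to be corrected, where `bs` and `bt` are the
outcomes of the Pauli-`X` measurements of the star vertices of colour `i` and `!i`, and `β w` is
the outcome of the Pauli-`Z` measurement of a qubit `w` outside `T`. -/
def correctionBit (c : G.Coloring Bool) (i : Bool) (T : Finset V) (bs bt : Fin 2)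
    (β : V → Fin 2) (u : V) : Fin 2 :=
  (if c u = i then bs else bt) + ∑ w ∈ oppositeRemoteSet c u \ T, β w

/-- Once the qubits outside `T ∪ {s, t}` have definite values, all signs are local, except those
of the non-adjacent pairs in `T`. -/
lemma exists_local_signs (c : G.Coloring Bool) {i : Bool} {s t : V} (hs : s ∈ starVertices c i)
    (ht : t ∈ starVertices c (!i)) {T : Finset V} (hsT : s ∉ T) (htT : t ∉ T) (bs bt : Fin 2)
    (β : V → Fin 2) :
    ∃ K : ℂ, ∀ x : V → Fin 2, (∀ w, w ∉ T → w ≠ s → w ≠ t → x w = β w) →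
      czSign bs (∑ u ∈ Finset.univ.filter (fun u => c u = i) \ {s}, x u) *
          czSign bt (∑ w ∈ Finset.univ.filter (fun w => c w = !i) \ {t}, x w) *
          ∏ u with c u = i, ∏ w ∈ oppositeRemoteSet c u, czSign (x u) (x w) =
        K * (∏ u ∈ T with c u = i, ∏ w ∈ oppositeRemoteSet c u ∩ T, czSign (x u) (x w)) *
          ∏ u ∈ T, czSign (correctionBit c i T bs bt β u) (x u) := by
  have hns := notMem_oppositeRemoteSet_of_mem_starVertices hs
  have hnt := notMem_oppositeRemoteSet_of_mem_starVertices ht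
  have hcs : c s = i := hs.1
  have hct : c t = !i := ht.1
  refine ⟨(∏ u ∈ (Finset.univ \ {s, t}) \ T, czSign (if c u = i then bs else bt) (β u)) *
    ∏ u ∈ Finset.univ \ T with c u = i, ∏ w ∈ oppositeRemoteSet c u \ T,
      czSign (β u) (β w), fun x hx => ?_⟩
  have hN : ∀ u, ∀ w ∈ oppositeRemoteSet c u \ T, x w = β w := by
    intro u w hw
    rw [Finset.mem_sdiff] at hw
    exact hx w hw.2 (fun e => hns u (e ▸ hw.1)) (fun e => hnt u (e ▸ hw.1))
  have hlin : czSign bs (∑ u ∈ Finset.univ.filter (fun u => c u = i) \ {s}, x u) *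
      czSign bt (∑ w ∈ Finset.univ.filter (fun w => c w = !i) \ {t}, x w) =
      ∏ u ∈ Finset.univ \ {s, t}, czSign (if c u = i then bs else bt) (x u) := by
    rw [czSign_sum_right, czSign_sum_right,
      ← Finset.prod_filter_mul_prod_filter_not (Finset.univ \ {s, t}) (fun u => c u = i)]
    congr 1
    · refine Finset.prod_congr ?_ ?_
      · ext u
        simp only [Finset.mem_sdiff, Finset.mem_filter, Finset.mem_univ, true_and,
          Finset.mem_insert, Finset.mem_singleton, not_or]
        constructor
        · rintro ⟨hu, hne⟩
          exact ⟨⟨hne, by rintro rfl; simp [hct] at hu⟩, hu⟩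
        · rintro ⟨⟨hne, _⟩, hu⟩
          exact ⟨hu, hne⟩
      · intro u hu
        rw [if_pos (Finset.mem_filter.1 hu).2]
    · refine Finset.prod_congr ?_ ?_
      · ext u
        simp only [Finset.mem_sdiff, Finset.mem_filter, Finset.mem_univ, true_and,
          Finset.mem_insert, Finset.mem_singleton, not_or, Bool.eq_not]
        constructor
        · rintro ⟨hu, hne⟩
          exact ⟨⟨by rintro rfl; exact hu hcs, hne⟩, hu⟩
        · rintro ⟨⟨_, hne⟩, hu⟩
          exact ⟨hu, hne⟩
      · intro u hu
        rw [if_neg (Finset.mem_filter.1 hu).2]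
  have hTsub : T ⊆ Finset.univ \ {s, t} := by
    intro u hu
    simp only [Finset.mem_sdiff, Finset.mem_univ, true_and, Finset.mem_insert,
      Finset.mem_singleton, not_or]
    exact ⟨fun e => hsT (e ▸ hu), fun e => htT (e ▸ hu)⟩
  have hout : ∏ u ∈ (Finset.univ \ {s, t}) \ T, czSign (if c u = i then bs else bt) (x u) =
      ∏ u ∈ (Finset.univ \ {s, t}) \ T, czSign (if c u = i then bs else bt) (β u) := by
    refine Finset.prod_congr rfl fun u hu => ?_
    simp only [Finset.mem_sdiff, Finset.mem_univ, true_and, Finset.mem_insert,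
      Finset.mem_singleton, not_or] at hu
    rw [hx u hu.2 hu.1.1 hu.1.2]
  have hboth : ∏ u ∈ Finset.univ \ T with c u = i, ∏ w ∈ oppositeRemoteSet c u \ T,
      czSign (x u) (x w) = ∏ u ∈ Finset.univ \ T with c u = i,
        ∏ w ∈ oppositeRemoteSet c u \ T, czSign (β u) (β w) := by
    refine Finset.prod_congr rfl fun u hu => Finset.prod_congr rfl fun w hw => ?_
    have hu' : u ∈ oppositeRemoteSet c w \ T := by
      rw [Finset.mem_sdiff, ← mem_oppositeRemoteSet_comm]
      simp only [Finset.mem_filter, Finset.mem_sdiff] at hu hw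
      exact ⟨hw.1, hu.1.2⟩
    rw [hN u w hw, hN w u hu']
  have hone : ∏ u ∈ T, ∏ w ∈ oppositeRemoteSet c u \ T, czSign (x w) (x u) =
      ∏ u ∈ T, czSign (∑ w ∈ oppositeRemoteSet c u \ T, β w) (x u) := by
    refine Finset.prod_congr rfl fun u _ => ?_
    rw [czSign_sum_left]
    exact Finset.prod_congr rfl fun w hw => by rw [hN u w hw]
  rw [hlin, prod_remote_split c i T, hboth, hone, ← Finset.prod_sdiff hTsub, hout]
  simp only [correctionBit, czSign_add_left, Finset.prod_mul_distrib]
  ring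

/-- The corrections that follow the measurement of the qubits `zs` in the Pauli-`Z` basis and of
the two star vertices in the Pauli-`X` basis: powers of Pauli-`Z` on the qubits `T`, then Hadamard
gates on the leaves `L`.  The list `bits` holds the outcomes in the order of the measurements;
outcomes beyond its end count as `0`. -/
noncomputable def correctionProtocol (c : G.Coloring Bool) (i : Bool) (T L : Finset V)
    (zs : List V) (bits : List (Fin 2)) : Protocol V :=
  Protocol.cliffordEach
    (fun u => phaseFlip (correctionBit c i T (bits.getD (zs.length + 1) 0)
      (bits.getD zs.length 0) (fun w => bits.getD (zs.idxOf w) 0) u))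
    (fun _ => isClifford_phaseFlip _) T.toList
    (Protocol.cliffordEach (fun _ => hadamard) (fun _ => isClifford_hadamard) L.toList .done)

/-- The state before the corrections: the sign `(-1)^(σ₁ σ₂)` of the two parities is gone, and the
qubits `s` and `t` are in a product state with the others. -/
lemma project_graphState (c : G.Coloring Bool) {i : Bool} {s t : V} (hs : s ∈ starVertices c i)
    (ht : t ∈ starVertices c (!i)) {zs : List V} (hsz : s ∉ zs) (htz : t ∉ zs) (bs bt : Fin 2)
    (β x : V → Fin 2) :
    project (zs.map (fun w => (w, Pauli.Z)) ++ [(t, Pauli.X), (s, Pauli.X)])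
        (zs.map β ++ [bt, bs]) (graphState G) x =
      2⁻¹ * (czSign bs bt * czSign bs (x s) * czSign bt (x t)) *
        ((if ∀ w ∈ zs, x w = β w then ((Real.sqrt 2 : ℂ)⁻¹) ^ Fintype.card V else 0) *
          (czSign bs (∑ u ∈ Finset.univ.filter (fun u => c u = i) \ {s}, x u) *
          czSign bt (∑ w ∈ Finset.univ.filter (fun w => c w = !i) \ {t}, x w) *
          ∏ u with c u = i, ∏ w ∈ oppositeRemoteSet c u, czSign (x u) (x w))) := by
  have hcs : c s = i := hs.1
  have hct : c t = !i := ht.1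
  have hst : s ≠ t := by rintro rfl; simp [hcs] at hct
  have hup : ∀ (x : V → Fin 2) (y z : Fin 2) (u : V), u ≠ s → u ≠ t →
      Function.update (Function.update x s y) t z u = x u := fun x y z u h1 h2 => by
    rw [Function.update_of_ne h2, Function.update_of_ne h1]
  have hns := notMem_oppositeRemoteSet_of_mem_starVertices hs
  have hnt := notMem_oppositeRemoteSet_of_mem_starVertices ht
  rw [project_append _ _ _ _ _ (by simp)]
  simp only [project]
  rw [applyAt_proj_X_proj_X hst bs bt
    (fun x => ∑ u ∈ Finset.univ.filter (fun u => c u = i) \ {s}, x u)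
    (fun x => ∑ w ∈ Finset.univ.filter (fun w => c w = !i) \ {t}, x w)
    (fun x => (if ∀ w ∈ zs, x w = β w then ((Real.sqrt 2 : ℂ)⁻¹) ^ Fintype.card V else 0) *
      ∏ u with c u = i, ∏ w ∈ oppositeRemoteSet c u, czSign (x u) (x w))]
  · ring
  · intro x y z
    refine Finset.sum_congr rfl fun u hu => hup x y z u ?_ ?_
    · rintro rfl; simp at hu
    · rintro rfl; simp [hct] at hu
  · intro x y z
    refine Finset.sum_congr rfl fun u hu => hup x y z u ?_ ?_
    · rintro rfl; simp [hcs] at hu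
    · rintro rfl; simp at hu
  · intro x y z
    have h1 : (∀ w ∈ zs, Function.update (Function.update x s y) t z w = β w) ↔
        ∀ w ∈ zs, x w = β w :=
      forall₂_congr fun w hw => by
        rw [hup x y z w (fun e => hsz (e ▸ hw)) (fun e => htz (e ▸ hw))]
    simp only [h1]
    congr 1
    refine Finset.prod_congr rfl fun u _ => Finset.prod_congr rfl fun w hw => ?_
    have hw' := mem_oppositeRemoteSet_comm.1 hw
    rw [hup x y z u (fun e => hns w (e ▸ hw')) (fun e => hnt w (e ▸ hw')),
      hup x y z w (fun e => hns u (e ▸ hw)) (fun e => hnt u (e ▸ hw))]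
  · intro x
    have hsum : ∀ (S : Finset V) (v : V), v ∈ S → ∑ u ∈ S, x u = x v + ∑ u ∈ S \ {v}, x u :=
      fun S v hv => by
        rw [add_comm, ← Finset.sum_sdiff (Finset.singleton_subset_iff.2 hv), Finset.sum_singleton]
    rw [project_Z, graphState_eq_remote c i,
      hsum (Finset.univ.filter fun u => c u = i) s (by simp [hcs]),
      hsum (Finset.univ.filter fun u => c u = !i) t (by simp [hct])]
    split_ifs
    · ring
    · simp

/-- The explicit protocol works for every choice of the star vertices and of the leaves. -/
lemma extractsRemoteGHZ_correctionProtocol (c : G.Coloring Bool) {i : Bool} {A : Finset V}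
    (hA : ∀ v ∈ A, c v = i ∧ v ∉ starVertices c i)
    (hdisj : ∀ v ∈ A, ∀ w ∈ A, v ≠ w → Disjoint (oppositeRemoteSet c v) (oppositeRemoteSet c w))
    {s t : V} (hs : s ∈ starVertices c i) (ht : t ∈ starVertices c (!i)) {R : V → Finset V}
    (hR : ∀ v ∈ A, R v ⊆ oppositeRemoteSet c v) {zs : List V} (hnd : zs.Nodup)
    (hzs : ∀ w, w ∈ zs ↔ w ∉ A ∧ w ∉ A.biUnion R ∧ w ≠ s ∧ w ≠ t) :
    ExtractsRemoteGHZ G (fun v : A => insert v.1 (R v.1))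
      (Protocol.measureList (zs.map (fun w => (w, Pauli.Z)) ++ [(t, Pauli.X), (s, Pauli.X)])
        (correctionProtocol c i (A ∪ A.biUnion R) (A.biUnion R) zs)) := by
  have hcs : c s = i := hs.1
  have hct : c t = !i := ht.1
  have hRc : ∀ v ∈ A, ∀ r ∈ R v, c r ≠ i ∧ ¬ G.Adj v r := fun v hv r hr => by
    have h := mem_oppositeRemoteSet.1 (hR v hv hr)
    rwa [(hA v hv).1] at h
  have hAR : ∀ v ∈ A, ∀ w ∈ A, v ∉ R w := fun v hv w hw h => (hRc w hw v h).1 (hA v hv).1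
  have hRR : ∀ v ∈ A, ∀ w ∈ A, ∀ r, r ∈ oppositeRemoteSet c v → r ∈ R w → w = v := by
    intro v hv w hw r h1 h2
    by_contra hne
    exact Finset.disjoint_left.1 (hdisj w hw v hv hne) (hR w hw h2) h1
  refine ⟨?_, ?_, ?_⟩
  · rintro ⟨v, hv⟩ ⟨w, hw⟩ hne
    have hvw : v ≠ w := fun e => hne (Subtype.ext e)
    rw [Finset.disjoint_left]
    intro r h1 h2
    rcases Finset.mem_insert.1 h1 with rfl | h1 <;> rcases Finset.mem_insert.1 h2 with h2 | h2
    · exact hvw h2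
    · exact hAR _ hv w hw h2
    · subst h2; exact hAR _ hw v hv h1
    · exact hvw (hRR v hv w hw r (hR v hv h1) h2).symm
  · rintro ⟨v, hv⟩ a ha b hb _ hab
    have hmem : ∀ a ∈ ((insert v (R v) : Finset V) : Set V), a = v ∨ a ∈ R v := by simp
    have hva := (hA v hv).1
    rcases hmem a ha with rfl | ha <;> rcases hmem b hb with rfl | hb
    · exact hab.ne rfl
    · exact (hRc _ hv b hb).2 hab
    · exact (hRc _ hv a ha).2 hab.symm
    · exact c.valid hab ((Bool.eq_not.2 (hRc v hv a ha).1).trans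
        (Bool.eq_not.2 (hRc v hv b hb).1).symm)
  set L := A.biUnion R with hL
  set T := A ∪ L with hT
  have hsA : s ∉ A := fun h => (hA s h).2 hs
  have htA : t ∉ A := fun h => by simpa [hct] using (hA t h).1
  have hsL : s ∉ L := fun h => by
    obtain ⟨v, hv, h⟩ := Finset.mem_biUnion.1 h
    exact notMem_oppositeRemoteSet_of_mem_starVertices hs v (hR v hv h)
  have htL : t ∉ L := fun h => by
    obtain ⟨v, hv, h⟩ := Finset.mem_biUnion.1 h
    exact notMem_oppositeRemoteSet_of_mem_starVertices ht v (hR v hv h)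
  have hsz : s ∉ zs := by simp [hzs]
  have htz : t ∉ zs := by simp [hzs]
  have hzT : ∀ w ∈ zs, w ∉ T := fun w hw => by
    have := (hzs w).1 hw
    simp only [hT, Finset.mem_union]; tauto
  have hout : ∀ w, w ∉ T → ∀ k : A, w ∉ insert k.1 (R k.1) := by
    intro w hw k h
    rcases Finset.mem_insert.1 h with rfl | h
    · exact hw (Finset.mem_union_left _ k.2)
    · exact hw (Finset.mem_union_right _ (Finset.mem_biUnion.2 ⟨_, k.2, h⟩))
  have hsT : s ∉ T := by simp [hT, hsA, hsL]
  have htT : t ∉ T := by simp [hT, htA, htL]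
  -- the centre of a leaf
  obtain ⟨ctr, hctr⟩ : ∃ ctr : V → V, ∀ v ∈ A, ∀ r ∈ R v, ctr r = v := by
    have : ∀ r, ∃ u, ∀ v ∈ A, r ∈ R v → u = v := by
      intro r
      by_cases h : ∃ u ∈ A, r ∈ R u
      · obtain ⟨u, hu, hr⟩ := h
        exact ⟨u, fun v hv hrv => hRR v hv u hu r (hR v hv hrv) hr⟩
      · exact ⟨r, fun v hv hrv => absurd ⟨v, hv, hrv⟩ h⟩
    choose ctr hctr using this
    exact ⟨ctr, fun v hv r hr => hctr r v hv hr⟩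
  have hprodL : ∀ f : V → V → ℂ, ∏ r ∈ L, f (ctr r) r = ∏ v ∈ A, ∏ r ∈ R v, f v r := by
    intro f
    rw [hL, Finset.prod_biUnion]
    · exact Finset.prod_congr rfl fun v hv => Finset.prod_congr rfl fun r hr => by
        rw [hctr v hv r hr]
    · intro v hv w hw hne
      exact (hdisj v hv w hw hne).mono (hR v hv) (hR w hw)
  have hTi : Finset.filter (fun u => c u = i) T = A := by
    ext u
    simp only [hT, Finset.mem_filter, Finset.mem_union]
    constructor
    · rintro ⟨h | h, hu⟩
      · exact h
      · obtain ⟨v, hv, h⟩ := Finset.mem_biUnion.1 h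
        exact absurd hu (hRc v hv u h).1
    · exact fun h => ⟨Or.inl h, (hA u h).1⟩
  have hNT : ∀ v ∈ A, oppositeRemoteSet c v ∩ T = R v := by
    intro v hv
    ext r
    simp only [hT, Finset.mem_inter, Finset.mem_union]
    constructor
    · rintro ⟨hr, h | h⟩
      · exact absurd ((hA r h).1.trans (hA v hv).1.symm) (mem_oppositeRemoteSet.1 hr).1
      · obtain ⟨w, hw, h⟩ := Finset.mem_biUnion.1 h
        rwa [← hRR v hv w hw r hr h]
    · exact fun hr => ⟨hR v hv hr, Or.inr (Finset.mem_biUnion.2 ⟨v, hv, hr⟩)⟩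
  refine guarantees_measureList fun bits hbits => ?_
  rw [correctionProtocol, guarantees_cliffordEach, guarantees_cliffordEach]
  generalize hβ : (fun w => bits.getD (zs.idxOf w) 0) = β
  generalize hbs : bits.getD (zs.length + 1) 0 = bs
  generalize hbt : bits.getD zs.length 0 = bt
  -- this uses that the entries of `zs` are distinct
  have hb : bits = zs.map β ++ [bt, bs] := by
    simp only [List.length_append, List.length_map, List.length_cons, List.length_nil] at hbits
    refine List.ext_getElem (by simp [hbits]) fun k h1 h2 => ?_
    rcases (by omega : k < zs.length ∨ k = zs.length ∨ k = zs.length + 1) with h | rfl | rfl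
    · rw [List.getElem_append_left (by simpa using h)]
      simp only [List.getElem_map, ← hβ, hnd.idxOf_getElem]
      rw [List.getD_eq_getElem _ _ h1]
    · simp [← hbt, h1]
    · simp [← hbs, h1]
  rw [hb]
  obtain ⟨K, hK⟩ := exists_local_signs c hs ht hsT htT bs bt β
  have hleaf : ∀ x : V → Fin 2, ∏ u ∈ T with c u = i, ∏ w ∈ oppositeRemoteSet c u ∩ T,
      czSign (x u) (x w) = (L.toList.map fun r => czSign (x (ctr r)) (x r)).prod := by
    intro x
    rw [Finset.prod_map_toList, hprodL fun v r => czSign (x v) (x r), hTi]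
    exact Finset.prod_congr rfl fun v hv => by rw [hNT v hv]
  -- the factor of the state that does not involve the qubits in `T`
  set h : QState V := fun x => (if ∀ w ∈ zs, x w = β w then 1 else 0) *
    (2⁻¹ * ((Real.sqrt 2 : ℂ)⁻¹) ^ Fintype.card V * K *
      (czSign bs bt * czSign bs (x s) * czSign bt (x t))) with hh
  -- The powers of `√2` come from the Hadamard gates and from the normalisation of the GHZ states.
  refine ⟨fun y => (if ∀ w (hw : w ∈ zs), y ⟨w, hout w (hzT w hw)⟩ = β w then 1 else 0) *
    (2⁻¹ * ((Real.sqrt 2 : ℂ)⁻¹) ^ Fintype.card V * K *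
      (czSign bs bt * czSign bs (y ⟨s, hout s hsT⟩) * czSign bt (y ⟨t, hout t htT⟩))) *
    ((Real.sqrt 2 : ℂ) ^ A.card * (Real.sqrt 2 : ℂ) ^ L.card), fun x => ?_⟩
  rw [applyEach_hadamard ctr L.toList L.nodup_toList ?_ h]
  · simp only [ghz_insert]
    rw [Finset.prod_coe_sort A
      (fun v => (Real.sqrt 2 : ℂ)⁻¹ * ∏ r ∈ R v, if x r = x v then 1 else 0),
      Finset.prod_map_toList, Finset.prod_mul_distrib, Finset.prod_mul_distrib,
      hprodL fun v r => if x r = x v then 1 else 0, Finset.prod_const, Finset.prod_const]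
    have h2 : ((Real.sqrt 2 : ℂ)⁻¹) ^ A.card * (Real.sqrt 2 : ℂ) ^ A.card = 1 := by
      rw [← mul_pow, inv_mul_cancel₀ (by simp), one_pow]
    simp only [hh]
    linear_combination (-(Real.sqrt 2 : ℂ) ^ L.card *
      (∏ v ∈ A, ∏ r ∈ R v, if x r = x v then 1 else 0) * h x) * h2
  · intro x r hr b
    rw [Finset.mem_toList] at hr
    have hrT : r ∈ T := Finset.mem_union_right _ hr
    have hz : (∀ w ∈ zs, Function.update x r b w = β w) ↔ ∀ w ∈ zs, x w = β w :=
      forall₂_congr fun w hw => by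
        rw [Function.update_of_ne]
        rintro rfl
        exact hzT w hw hrT
    simp only [hh, hz]
    have hsr : s ≠ r := fun e => hsL (e ▸ hr)
    have htr : t ≠ r := fun e => htL (e ▸ hr)
    rw [Function.update_of_ne hsr, Function.update_of_ne htr]
  · intro x
    simp only [phaseFlip]
    rw [applyEach_diagonal, project_graphState c hs ht hsz htz, Finset.prod_map_toList]
    by_cases hx : ∀ w ∈ zs, x w = β w
    · have hsq : (∏ u ∈ T, czSign (correctionBit c i T bs bt β u) (x u)) *
          ∏ u ∈ T, czSign (correctionBit c i T bs bt β u) (x u) = 1 := by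
        rw [← Finset.prod_mul_distrib]
        exact Finset.prod_eq_one fun u _ => czSign_mul_self _ _
      rw [hK x, hleaf]
      · simp only [hh, if_pos hx]
        linear_combination (2⁻¹ * ((Real.sqrt 2 : ℂ)⁻¹) ^ Fintype.card V * K *
          (czSign bs bt * czSign bs (x s) * czSign bt (x t)) *
          (L.toList.map fun r => czSign (x (ctr r)) (x r)).prod) * hsq
      · intro w hw hws hwt
        refine hx w ((hzs w).2 ?_)
        simp only [hT, Finset.mem_union, not_or] at hw
        exact ⟨hw.1, hw.2, hws, hwt⟩
    · simp [hh, if_neg hx]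
  · intro r hr hc
    rw [Finset.mem_toList] at hr hc
    obtain ⟨v, hv, hr⟩ := Finset.mem_biUnion.1 hr
    rw [hctr v hv r hr] at hc
    obtain ⟨w, hw, hc⟩ := Finset.mem_biUnion.1 hc
    exact hAR v hv w hw hc

lemma noMeasurement_correctionProtocol (c : G.Coloring Bool) (i : Bool) (T L : Finset V)
    (zs : List V) (bits : List (Fin 2)) : (correctionProtocol c i T L zs bits).NoMeasurement :=
  noMeasurement_cliffordEach (noMeasurement_cliffordEach trivial)

end Graph

end RemoteGHZ

theorem lemma1 {V : Type*} [Fintype V] [DecidableEq V]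
    (G : SimpleGraph V) [DecidableRel G.Adj] (c : G.Coloring Bool)
    (hstar : ∀ j : Bool, (starVertices c j).Nonempty)
    (n : ℕ) (hn : 1 ≤ n)
    (i : Bool) (A : Finset V)
    (hA : ∀ v ∈ A, c v = i ∧ v ∉ starVertices c i)
    (hcard : ∀ v ∈ A, n - 1 ≤ (oppositeRemoteSet c v).card)
    (hdisj : ∀ v ∈ A, ∀ w ∈ A, v ≠ w → Disjoint (oppositeRemoteSet c v) (oppositeRemoteSet c w)) :
    -- `|A|` GHZ states on `n` mutually remote nodes each can be extracted concurrently
    CanExtractRemoteGHZ G A.card n ∧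
    -- explicit construction, for any star vertices `s`, `t` and any choice of the leaves `R v`
    ∀ s ∈ starVertices c i, ∀ t ∈ starVertices c (!i),
      ∀ R : V → Finset V, (∀ v ∈ A, R v ⊆ oppositeRemoteSet c v) →
      ∀ zs : List V, zs.Nodup →
        (∀ w, w ∈ zs ↔ w ∉ A ∧ w ∉ A.biUnion R ∧ w ≠ s ∧ w ≠ t) →
        ∃ corr : List (Fin 2) → Protocol V, (∀ bs, (corr bs).NoMeasurement) ∧
          ExtractsRemoteGHZ G (fun v : A => insert v.1 (R v.1))
            (Protocol.measureList
              (zs.map (fun w => (w, Pauli.Z)) ++ [(t, Pauli.X), (s, Pauli.X)]) corr) := by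
  have hexplicit := fun (s : V) (hs : s ∈ starVertices c i) (t : V)
    (ht : t ∈ starVertices c (!i)) (R : V → Finset V)
    (hR : ∀ v ∈ A, R v ⊆ oppositeRemoteSet c v) (zs : List V) (hnd : zs.Nodup)
    (hzs : ∀ w, w ∈ zs ↔ w ∉ A ∧ w ∉ A.biUnion R ∧ w ≠ s ∧ w ≠ t) =>
    extractsRemoteGHZ_correctionProtocol c hA hdisj hs ht hR hnd hzs
  refine ⟨?_, fun s hs t ht R hR zs hnd hzs =>
    ⟨_, noMeasurement_correctionProtocol c i _ _ zs, hexplicit s hs t ht R hR zs hnd hzs⟩⟩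
  obtain ⟨s, hs⟩ := hstar i
  obtain ⟨t, ht⟩ := hstar (!i)
  have hchoice : ∀ v, ∃ S : Finset V, v ∈ A → S ⊆ oppositeRemoteSet c v ∧ S.card = n - 1 := by
    intro v
    by_cases hv : v ∈ A
    · obtain ⟨S, hS⟩ := Finset.exists_subset_card_eq (hcard v hv)
      exact ⟨S, fun _ => hS⟩
    · exact ⟨∅, fun h => absurd h hv⟩
  choose R hR using hchoice
  refine ⟨fun k => insert (A.equivFin.symm k).1 (R (A.equivFin.symm k).1), fun k => ?_, _,
    (hexplicit s hs t ht R (fun v hv => (hR v hv).1)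
      (Finset.univ.filter fun w => w ∉ A ∧ w ∉ A.biUnion R ∧ w ≠ s ∧ w ≠ t).toList
      (Finset.nodup_toList _) (fun w => by simp)).reindex A.equivFin.symm⟩
  have hk := (A.equivFin.symm k).2
  rw [Finset.card_insert_of_notMem, (hR _ hk).2, Nat.sub_add_cancel hn]
  exact fun h => (mem_oppositeRemoteSet.1 ((hR _ hk).1 h)).1 rfl
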